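/- Let $G$ be a finite simple graph that is connected, $k$-regular with $k\ge 1$, and equiarboreal, meaning that the number of spanning trees of $G$ containing a given edge does not depend on the edge. Then the edge-connectivity $\lambda(G)$ (the largest $j$ such that deleting fewer than $j$ edges never disconnects $G$) equals $k$. Moreover, call a set of edges an edge cut if it is the set of all edges of $G$ with one end in $A$ and the other in $B$, for some partition $V(G)=A\sqcup B$ into two nonempty sets. If $k\ge 11$, then the edge cuts of $G$ with exactly $k$ edges are precisely the sets $\{e\in E(G): v\in e\}$ of all edges incident with a single vertex $v\in V(G)$. -/

import Mathlib

namespace SimpleGraph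

variable {V : Type*}

/-- The spanning trees of `G`, as graphs on the full vertex set of `G`. -/
def spanningTrees (G : SimpleGraph V) : Set (SimpleGraph V) :=
  {T | T ≤ G ∧ T.IsTree}

/-- `G` is equiarboreal: the number of spanning trees containing a given edge does not depend
on the edge. (Meant for finite `G`, where the sets counted below are finite.) -/
def IsEquiarboreal (G : SimpleGraph V) : Prop :=
  ∀ e ∈ G.edgeSet, ∀ f ∈ G.edgeSet,
    {T ∈ G.spanningTrees | e ∈ T.edgeSet}.ncard = {T ∈ G.spanningTrees | f ∈ T.edgeSet}.ncard

/-- `C` is an edge cut of `G`: the set of all edges of `G` between the two parts of some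
partition of the vertex set into two nonempty parts `A` and `Aᶜ`. -/
def IsEdgeCut (G : SimpleGraph V) (C : Set (Sym2 V)) : Prop :=
  ∃ A : Set V, A.Nonempty ∧ Aᶜ.Nonempty ∧
    C = {e | ∃ u ∈ A, ∃ v ∈ Aᶜ, G.Adj u v ∧ e = s(u, v)}

/-- The edge-connectivity of `G` is `l`: this is the largest number `j` such that `G` is
`j`-edge-connected, i.e. such that deleting fewer than `j` edges never disconnects `G`. -/
def HasEdgeConnectivity (G : SimpleGraph V) (l : ℕ) : Prop :=
  IsGreatest {j : ℕ | G.IsEdgeConnected j} l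

end SimpleGraph

/-!
In an equiarboreal graph every edge lies in the same proportion of the spanning trees. Each spanning
tree has `n - 1` of the `nk / 2` edges, so this proportion is `2(n-1)/(nk) < 2/k`
(`SimpleGraph.IsEquiarboreal.card_treeFinset_adj`). By Kirchhoff, the proportion of spanning trees
through `uv` is the effective resistance between `u` and `v`, and hence by Dirichlet's principle
at least `(f u - f v)² / E(f)` for every test function `f`, where `E` is the Dirichlet energy. So
`k (f u - f v)² < 2 E(f)` for all edges `uv` and all `f` with `f u ≠ f v`
(`SimpleGraph.IsEquiarboreal.mul_sq_lt_dirichletForm`), and the proof consists in choosing `f` well.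

The part of Kirchhoff's theorem that is needed is `SimpleGraph.dirichletForm_forestPotential`: the
function counting the two-component forests that separate `u` from `v` and have a given vertex on
the side of `u` has Laplacian `τ (δ_u - δ_v)`, where `τ` is the number of spanning trees. Deleting
and adding an edge `xy` turns these forests into spanning trees through `xy`, and in each tree the
sum in question telescopes along the path from `u` to `v`. The bound on the resistance is then the
Cauchy-Schwarz inequality for the Dirichlet form.

Now take a minimum edge cut between `A` and its complement, with `c ≤ k` edges and at least two
vertices on either side. Let `uv` be a cut edge, and `x`, `y` the numbers of cut edges at `u` and
`v`. As moving a vertex to the other side does not make the cut smaller, `x, y ≤ k / 2`; and `uv`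
can be chosen with `x * y ≤ c`. The test functions are constant on `A` and the negative constant on its
complement, except at `u` and `v`. One of them contradicts the resistance bound if `c = k ≥ 11` or
`c < k`, apart from the cases `k = 5`, `c = 4` and `k = 7`, `c = 6`; here it is used that `c` is
even if `k` is even. There a second correction at all ends of cut edges is enough; this is
`SimpleGraph.IsEquiarboreal.card_eq_one_of_minimum_cut`. So every minimum cut with `c < k`, or with
`c = k ≥ 11`, splits off a single vertex. A cut of that kind has exactly `k` edges, which excludes
`c < k`.
-/

namespace SimpleGraph

/-! ### Two-component forests -/

variable {V : Type*}

/-- `F` is a forest with exactly two components, one containing `u` and the other `v`. -/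
structure IsTwoForest (F : SimpleGraph V) (u v : V) : Prop where
  isAcyclic : F.IsAcyclic
  not_reachable : ¬ F.Reachable u v
  reachable_or : ∀ w, F.Reachable u w ∨ F.Reachable v w

lemma IsTwoForest.of_not_reachable {F : SimpleGraph V} {u v x y : V} (h : F.IsTwoForest u v)
    (hxy : ¬ F.Reachable x y) : F.IsTwoForest x y := by
  refine ⟨h.isAcyclic, hxy, fun w ↦ ?_⟩
  rcases h.reachable_or x with hx | hx <;> rcases h.reachable_or y with hy | hy <;>
    rcases h.reachable_or w with hw | hw
  · exact absurd (hx.symm.trans hy) hxy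
  · exact absurd (hx.symm.trans hy) hxy
  · exact .inl (hx.symm.trans hw)
  · exact .inr (hy.symm.trans hw)
  · exact .inr (hy.symm.trans hw)
  · exact .inl (hx.symm.trans hw)
  · exact absurd (hx.symm.trans hy) hxy
  · exact absurd (hx.symm.trans hy) hxy

lemma IsTree.isTwoForest_deleteEdges {T : SimpleGraph V} {x y : V} (hT : T.IsTree)
    (h : T.Adj x y) : (T.deleteEdges {s(x, y)}).IsTwoForest x y := by
  refine ⟨hT.isAcyclic.anti (deleteEdges_le _), ?_, fun w ↦ ?_⟩
  · exact isBridge_iff.mp (isAcyclic_iff_forall_adj_isBridge.mp hT.isAcyclic h)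
  · have hw := (reachable_iff_reflTransGen x w).mp (hT.connected.preconnected x w)
    induction hw with
    | refl => exact .inl .rfl
    | @tail a b _ hab ih =>
      by_cases he : s(a, b) = s(x, y)
      · rcases Sym2.eq_iff.mp he with ⟨_, rfl⟩ | ⟨_, rfl⟩
        · exact .inr .rfl
        · exact .inl .rfl
      · have hab' : (T.deleteEdges {s(x, y)}).Adj a b := by
          rw [deleteEdges_adj]; exact ⟨hab, he⟩
        exact ih.imp (·.trans hab'.reachable) (·.trans hab'.reachable)

lemma IsTwoForest.isTree_sup_edge {F : SimpleGraph V} {x y : V} (h : F.IsTwoForest x y) :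
    (F ⊔ edge x y).IsTree := by
  have hne : x ≠ y := fun e ↦ h.not_reachable (e ▸ .rfl)
  have hxy : (F ⊔ edge x y).Adj x y := .inr ((edge_adj ..).mpr ⟨.inl ⟨rfl, rfl⟩, hne⟩)
  have hx : ∀ w, (F ⊔ edge x y).Reachable x w := fun w ↦
    (h.reachable_or w).elim (·.mono le_sup_left)
      fun hw ↦ hxy.reachable.trans (hw.mono le_sup_left)
  exact ⟨(connected_iff_exists_forall_reachable _).mpr ⟨x, hx⟩,
    h.isAcyclic.sup_edge_of_not_reachable h.not_reachable⟩

lemma IsTwoForest.deleteEdges_sup_edge {F : SimpleGraph V} {x y : V} (h : F.IsTwoForest x y) :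
    (F ⊔ edge x y).deleteEdges {s(x, y)} = F := by
  have hn : ¬ F.Adj x y := fun e ↦ h.not_reachable e.reachable
  ext a b
  simp only [deleteEdges_adj, sup_adj, edge_adj, Set.mem_singleton_iff, Sym2.eq_iff]
  constructor
  · tauto
  · refine fun hab ↦ ⟨.inl hab, ?_⟩
    rintro (⟨rfl, rfl⟩ | ⟨rfl, rfl⟩)
    · exact hn hab
    · exact hn hab.symm

lemma deleteEdges_sup_edge_of_adj {T : SimpleGraph V} {x y : V} (h : T.Adj x y) :
    T.deleteEdges {s(x, y)} ⊔ edge x y = T := by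
  ext a b
  simp only [deleteEdges_adj, sup_adj, edge_adj, Set.mem_singleton_iff, Sym2.eq_iff]
  constructor
  · rintro (h' | ⟨⟨rfl, rfl⟩ | ⟨rfl, rfl⟩, _⟩)
    exacts [h'.1, h, h.symm]
  · intro hab
    have := hab.ne
    tauto

/-! ### Kirchhoff's theorem and the resistance bound -/

section Potential

open Classical Finset

variable [Fintype V]

/-- The spanning trees of `G`, as a finset. -/
noncomputable def treeFinset (G : SimpleGraph V) : Finset (SimpleGraph V) :=
  {T | T ≤ G ∧ T.IsTree}

/-- The spanning forests of `G` with two components that separate `u` from `v`. -/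
noncomputable def twoForests (G : SimpleGraph V) (u v : V) : Finset (SimpleGraph V) :=
  {F | F ≤ G ∧ F.IsTwoForest u v}

/-- The Dirichlet form of `G`: the sum of `(f x - f y) * (g x - g y)` over the edges `xy`. It is
written as half of the sum over ordered pairs of adjacent vertices. -/
noncomputable def dirichletForm (G : SimpleGraph V) (f g : V → ℝ) : ℝ :=
  (∑ x, ∑ y, if G.Adj x y then (f x - f y) * (g x - g y) else 0) / 2

/-- The number of spanning forests with two components that separate `u` from `v` and have `w` on
the side of `u`. Up to a constant factor this is the electrical potential of a current from
`u` to `v`. -/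
noncomputable def forestPotential (G : SimpleGraph V) (u v w : V) : ℝ :=
  ∑ F ∈ G.twoForests u v, if F.Reachable u w then 1 else 0

lemma sum_twoForests {G : SimpleGraph V} {x y : V} (h : G.Adj x y) (c : SimpleGraph V → ℝ) :
    ∑ F ∈ G.twoForests x y, c F =
      ∑ T ∈ G.treeFinset with T.Adj x y, c (T.deleteEdges {s(x, y)}) := by
  symm
  refine sum_bij' (fun T _ ↦ T.deleteEdges {s(x, y)}) (fun F _ ↦ F ⊔ edge x y) ?_ ?_ ?_ ?_ ?_
  · intro T hT
    simp only [treeFinset, twoForests, mem_filter, mem_univ, true_and] at hT ⊢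
    exact ⟨(deleteEdges_le _).trans hT.1.1, hT.1.2.isTwoForest_deleteEdges hT.2⟩
  · intro F hF
    simp only [treeFinset, twoForests, mem_filter, mem_univ, true_and] at hF ⊢
    refine ⟨⟨sup_le hF.1 (by simpa [edge_le_iff] using .inr h), hF.2.isTree_sup_edge⟩, ?_⟩
    exact .inr ((edge_adj ..).mpr ⟨.inl ⟨rfl, rfl⟩, h.ne⟩)
  · intro T hT
    exact deleteEdges_sup_edge_of_adj (mem_filter.mp hT).2
  · intro F hF
    exact (mem_filter.mp hF).2.2.deleteEdges_sup_edge
  · intros; rfl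

/-- A two-component forest separating both `u` from `v` and `x` from `y` plays the same role for
either pair, which exchanges the roles of the pairs. -/
lemma forestPotential_sub (G : SimpleGraph V) (u v x y : V) :
    G.forestPotential u v x - G.forestPotential u v y =
      ∑ F ∈ G.twoForests x y,
        ((if F.Reachable x u then 1 else 0) - (if F.Reachable x v then 1 else 0)) := by
  rw [forestPotential, forestPotential, ← sum_sub_distrib, twoForests, twoForests, sum_filter,
    sum_filter]
  refine sum_congr rfl fun F _ ↦ ?_
  by_cases hG : F ≤ G
  swap
  · simp [hG]
  simp only [hG, true_and]
  by_cases huv : F.Reachable u v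
  · rw [if_neg fun h ↦ h.not_reachable huv]
    have : F.Reachable x u ↔ F.Reachable x v := ⟨(·.trans huv), (·.trans huv.symm)⟩
    simp [this]
  by_cases hxy : F.Reachable x y
  · rw [if_neg (c := F.IsTwoForest x y) fun h ↦ h.not_reachable hxy]
    have : F.Reachable u x ↔ F.Reachable u y := ⟨(·.trans hxy), (·.trans hxy.symm)⟩
    simp [this]
  by_cases hF : F.IsTwoForest u v
  · -- both conditions say that `u` and `x` are in different components, as there are only two
    have huy : F.Reachable u y ↔ F.Reachable x v :=
      ⟨fun h ↦ ((hF.reachable_or x).resolve_left fun h' ↦ hxy (h'.symm.trans h)).symm,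
        fun h ↦ (hF.reachable_or y).resolve_right fun h' ↦ hxy (h.trans h')⟩
    have hux : F.Reachable u x ↔ F.Reachable x u := reachable_comm
    simp only [hF, hF.of_not_reachable hxy, if_true, huy, hux]
  · rw [if_neg hF, if_neg fun h ↦ hF (h.of_not_reachable huv)]

/-- In a tree `T`, deleting an edge `xy` separates `u` from `v` precisely if `xy` lies on the path
between them, so the sum of the differences of `g` over these edges telescopes. -/
lemma IsTree.sum_sub_eq {T : SimpleGraph V} (hT : T.IsTree) (g : V → ℝ) (u v : V) :
    (∑ x, ∑ y, if T.Adj x y then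
      ((if (T.deleteEdges {s(x, y)}).Reachable x u then 1 else 0) -
        (if (T.deleteEdges {s(x, y)}).Reachable x v then 1 else 0)) * (g x - g y) else 0) =
      2 * (g u - g v) := by
  have hstep : ∀ a b, T.Adj a b → (∑ x, ∑ y, if T.Adj x y then
      ((if (T.deleteEdges {s(x, y)}).Reachable x a then 1 else 0) -
        (if (T.deleteEdges {s(x, y)}).Reachable x b then 1 else 0)) * (g x - g y) else 0) =
      2 * (g a - g b) := by
    intro a b hab
    have : ∀ x y, (if T.Adj x y then
      ((if (T.deleteEdges {s(x, y)}).Reachable x a then 1 else 0) -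
        (if (T.deleteEdges {s(x, y)}).Reachable x b then 1 else 0)) * (g x - g y) else 0) =
        (if x = a then if y = b then g a - g b else 0 else 0) +
        (if x = b then if y = a then g a - g b else 0 else 0) := by
      intro x y
      by_cases h1 : x = a ∧ y = b
      · obtain ⟨rfl, rfl⟩ := h1
        have := (hT.isTwoForest_deleteEdges hab).not_reachable
        simp [this, hab, hab.ne]
      by_cases h2 : x = b ∧ y = a
      · obtain ⟨rfl, rfl⟩ := h2
        have := (hT.isTwoForest_deleteEdges hab.symm).not_reachable
        simp [this, hab.symm, hab.symm.ne]
      have hr : (if x = a then if y = b then g a - g b else 0 else 0) +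
          (if x = b then if y = a then g a - g b else 0 else 0) = 0 := by
        split_ifs <;> simp_all
      rw [hr]
      have hadj : (T.deleteEdges {s(x, y)}).Adj a b := by
        rw [deleteEdges_adj, Set.mem_singleton_iff, Sym2.eq_iff]
        refine ⟨hab, ?_⟩
        rintro (⟨rfl, rfl⟩ | ⟨rfl, rfl⟩)
        · exact h1 ⟨rfl, rfl⟩
        · exact h2 ⟨rfl, rfl⟩
      have : (T.deleteEdges {s(x, y)}).Reachable x a ↔ (T.deleteEdges {s(x, y)}).Reachable x b :=
        ⟨(·.trans hadj.reachable), (·.trans hadj.symm.reachable)⟩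
      simp [this]
    simp only [this, sum_add_distrib]
    simp
    ring
  have huv := (reachable_iff_reflTransGen u v).mp (hT.connected.preconnected u v)
  induction huv with
  | refl => simp
  | @tail a b _ hab ih =>
    have : 2 * (g u - g b) = 2 * (g u - g a) + 2 * (g a - g b) := by ring
    rw [this, ← ih, ← hstep a b hab]
    simp only [← sum_add_distrib]
    refine sum_congr rfl fun x _ ↦ sum_congr rfl fun y _ ↦ ?_
    split_ifs <;> ring

/-- Kirchhoff's theorem: the forest potential has Laplacian `τ (δ_u - δ_v)`, where `τ` is the
number of spanning trees. -/
lemma dirichletForm_forestPotential (G : SimpleGraph V) (u v : V) (g : V → ℝ) :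
    G.dirichletForm (G.forestPotential u v) g = #G.treeFinset * (g u - g v) := by
  have h1 : ∀ x y, (if G.Adj x y then
      (G.forestPotential u v x - G.forestPotential u v y) * (g x - g y) else 0) =
      ∑ T ∈ G.treeFinset, if T.Adj x y then
        ((if (T.deleteEdges {s(x, y)}).Reachable x u then 1 else 0) -
        (if (T.deleteEdges {s(x, y)}).Reachable x v then 1 else 0)) * (g x - g y) else 0 := by
    intro x y
    split_ifs with h
    · rw [forestPotential_sub, sum_twoForests h, sum_mul, sum_filter]
      exact sum_congr rfl fun T _ ↦ by congr
    · refine (sum_eq_zero fun T hT ↦ if_neg fun h' ↦ h ?_).symm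
      exact (mem_filter.mp hT).2.1 h'
  have h2 : ∑ x, ∑ y, (if G.Adj x y then
      (G.forestPotential u v x - G.forestPotential u v y) * (g x - g y) else 0) =
      ∑ T ∈ G.treeFinset, 2 * (g u - g v) := by
    simp only [h1]
    rw [sum_congr rfl fun x _ ↦ sum_comm, sum_comm]
    exact sum_congr rfl fun T hT ↦ (mem_filter.mp hT).2.2.sum_sub_eq g u v
  rw [dirichletForm, h2, sum_const, nsmul_eq_mul]
  ring

lemma dirichletForm_sq_le (G : SimpleGraph V) (f g : V → ℝ) :
    G.dirichletForm f g ^ 2 ≤ G.dirichletForm f f * G.dirichletForm g g := by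
  let s : Finset (V × V) := {p | G.Adj p.1 p.2}
  have h : ∀ a b : V → ℝ, G.dirichletForm a b =
      (∑ p ∈ s, (a p.1 - a p.2) * (b p.1 - b p.2)) / 2 := by
    intro a b
    rw [dirichletForm, sum_filter, ← univ_product_univ, sum_product]
  have := sum_mul_sq_le_sq_mul_sq s (fun p ↦ f p.1 - f p.2) (fun p ↦ g p.1 - g p.2)
  simp only [h, ← sq]
  rw [div_pow]
  linarith

/-- Dirichlet's principle, in the form of a lower bound for the number of spanning trees through the
edge `uv`. -/
lemma card_treeFinset_mul_sq_le {G : SimpleGraph V} (hG : G.Connected) {u v : V} (h : G.Adj u v)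
    (f : V → ℝ) : #G.treeFinset * (f u - f v) ^ 2 ≤
      #{T ∈ G.treeFinset | T.Adj u v} * G.dirichletForm f f := by
  have hpos : (0 : ℝ) < #G.treeFinset := by
    obtain ⟨T, hT⟩ := hG.exists_isTree_le
    exact_mod_cast card_pos.mpr ⟨T, by simpa [treeFinset] using hT⟩
  have h1 : G.forestPotential u v u - G.forestPotential u v v = #{T ∈ G.treeFinset | T.Adj u v} := by
    rw [forestPotential_sub, sum_twoForests h, card_eq_sum_ones, Nat.cast_sum]
    refine sum_congr rfl fun T hT ↦ ?_
    simp only [treeFinset, mem_filter, mem_univ, true_and] at hT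
    simp [(hT.1.2.isTwoForest_deleteEdges hT.2).not_reachable]
  have h2 := G.dirichletForm_sq_le (G.forestPotential u v) f
  rw [dirichletForm_forestPotential, dirichletForm_forestPotential, h1] at h2
  refine le_of_mul_le_mul_left ?_ hpos
  linarith

end Potential

/-! ### The number of spanning trees through an edge -/

section Counting

open Classical Finset

variable {V : Type*} [Fintype V]

lemma sum_adj_eq_degree (G : SimpleGraph V) [DecidableRel G.Adj] (x : V) :
    (∑ y, if G.Adj x y then (1 : ℝ) else 0) = G.degree x := by
  rw [sum_boole, ← card_neighborFinset_eq_degree, neighborFinset_eq_filter]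

lemma IsTree.sum_adj_eq {T : SimpleGraph V} (hT : T.IsTree) :
    (∑ x, ∑ y, if T.Adj x y then (1 : ℝ) else 0) = 2 * (Fintype.card V - 1) := by
  have h := T.sum_degrees_eq_twice_card_edges
  have h' := hT.card_edgeFinset
  simp only [sum_adj_eq_degree]
  rw [← Nat.cast_sum, h, ← h']
  push_cast
  ring

lemma ncard_spanningTrees_eq (G : SimpleGraph V) (u v : V) :
    {T ∈ G.spanningTrees | s(u, v) ∈ T.edgeSet}.ncard = #{T ∈ G.treeFinset | T.Adj u v} := by
  rw [← Set.ncard_coe_finset]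
  congr 1
  ext T
  simp [spanningTrees, treeFinset]

/-- Every edge of a `k`-regular equiarboreal graph lies in the same number of spanning trees, and
by counting pairs of a spanning tree and an edge in it, this is a `2(n-1)/(nk)` proportion of all
spanning trees. -/
lemma IsEquiarboreal.card_treeFinset_adj {G : SimpleGraph V} (hequi : G.IsEquiarboreal) {k : ℕ}
    (hreg : ∀ x, ∑ y, (if G.Adj x y then (1 : ℝ) else 0) = k) {u v : V} (h : G.Adj u v) :
    (Fintype.card V : ℝ) * k * #{T ∈ G.treeFinset | T.Adj u v} =
      2 * (Fintype.card V - 1) * #G.treeFinset := by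
  have h1 : ∀ x y, (∑ T ∈ G.treeFinset, if T.Adj x y then (1 : ℝ) else 0) =
      if G.Adj x y then (#{T ∈ G.treeFinset | T.Adj u v} : ℝ) else 0 := by
    intro x y
    split_ifs with hxy
    · rw [sum_boole, ← ncard_spanningTrees_eq, ← ncard_spanningTrees_eq]
      exact_mod_cast hequi _ hxy _ h
    · exact sum_eq_zero fun T hT ↦ if_neg fun h' ↦ hxy ((mem_filter.mp hT).2.1 h')
  have h2 : ∑ x, ∑ y, (∑ T ∈ G.treeFinset, if T.Adj x y then (1 : ℝ) else 0) =
      ∑ T ∈ G.treeFinset, 2 * ((Fintype.card V : ℝ) - 1) := by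
    rw [sum_congr rfl fun x _ ↦ sum_comm, sum_comm]
    exact sum_congr rfl fun T hT ↦ (mem_filter.mp hT).2.2.sum_adj_eq
  simp only [h1] at h2
  have h3 : ∀ x, ∑ y, (if G.Adj x y then (#{T ∈ G.treeFinset | T.Adj u v} : ℝ) else 0) =
      k * #{T ∈ G.treeFinset | T.Adj u v} := by
    intro x
    rw [← hreg x, sum_mul]
    exact sum_congr rfl fun y _ ↦ by split_ifs <;> simp
  simp only [h3, sum_const, nsmul_eq_mul, card_univ] at h2
  linarith

/-- The effective resistance across any edge of a `k`-regular equiarboreal graph is less than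
`2 / k`. -/
lemma IsEquiarboreal.mul_sq_lt_dirichletForm {G : SimpleGraph V} (hequi : G.IsEquiarboreal)
    (hG : G.Connected) {k : ℕ} (hk : 1 ≤ k)
    (hreg : ∀ x, ∑ y, (if G.Adj x y then (1 : ℝ) else 0) = k) {u v : V} (h : G.Adj u v)
    {f : V → ℝ} (hf : f u ≠ f v) : k * (f u - f v) ^ 2 < 2 * G.dirichletForm f f := by
  have hpos : (0 : ℝ) < #G.treeFinset := by
    obtain ⟨T, hT⟩ := hG.exists_isTree_le
    exact_mod_cast card_pos.mpr ⟨T, by simpa [treeFinset] using hT⟩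
  have hn : (1 : ℝ) ≤ Fintype.card V := by
    exact_mod_cast Fintype.card_pos_iff.mpr ⟨u⟩
  have hk' : (0 : ℝ) < k := by exact_mod_cast hk
  have h1 := card_treeFinset_mul_sq_le hG h f
  have h2 := hequi.card_treeFinset_adj hreg h
  have hsq : 0 < (f u - f v) ^ 2 := by
    have := sub_ne_zero.mpr hf
    positivity
  set n : ℝ := ((Fintype.card V : ℕ) : ℝ)
  set t : ℝ := ((#{T ∈ G.treeFinset | T.Adj u v} : ℕ) : ℝ)
  set τ : ℝ := ((#G.treeFinset : ℕ) : ℝ)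
  set E := G.dirichletForm f f
  have h3 : n * (k * (f u - f v) ^ 2) ≤ 2 * (n - 1) * E := by
    refine le_of_mul_le_mul_left ?_ hpos
    calc τ * (n * (k * (f u - f v) ^ 2)) = n * k * (τ * (f u - f v) ^ 2) := by ring
      _ ≤ n * k * (t * E) := by gcongr
      _ = n * k * t * E := by ring
      _ = τ * (2 * (n - 1) * E) := by rw [h2]; ring
  have hE : 0 < E := by
    by_contra! hE
    have : 0 < n * (k * (f u - f v) ^ 2) := by positivity
    nlinarith
  refine lt_of_mul_lt_mul_left (a := n) ?_ (by linarith)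
  linarith

end Counting

/-! ### Cuts and the energies of test functions -/

section Cut

open Classical Finset

variable {V : Type*}

/-- The function that is `1` on `A` and `-1` off `A`. -/
noncomputable def sideSign (A : Finset V) (x : V) : ℝ := if x ∈ A then 1 else -1

lemma sideSign_mul_self (A : Finset V) (x : V) : sideSign A x * sideSign A x = 1 := by
  unfold sideSign; split_ifs <;> norm_num

variable [Fintype V]

lemma dirichletForm_comm (G : SimpleGraph V) (f g : V → ℝ) :
    G.dirichletForm f g = G.dirichletForm g f := by
  simp only [dirichletForm, mul_comm]

lemma dirichletForm_eq_sum (G : SimpleGraph V) (f g : V → ℝ) :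
    G.dirichletForm f g = ∑ x, g x * ∑ y, if G.Adj x y then f x - f y else 0 := by
  have h : ∑ x, ∑ y, (if G.Adj x y then (f x - f y) * (g x - g y) else 0) =
      ∑ x, ∑ y, g x * (if G.Adj x y then f x - f y else 0) +
      ∑ y, ∑ x, g x * (if G.Adj x y then f x - f y else 0) := by
    simp only [← sum_add_distrib]
    refine sum_congr rfl fun x _ ↦ sum_congr rfl fun y _ ↦ ?_
    simp only [G.adj_comm y x]
    split_ifs <;> ring
  rw [dirichletForm, h, sum_comm (f := fun y x ↦ g x * (if G.Adj x y then f x - f y else 0))]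
  simp only [mul_sum]
  ring

lemma dirichletForm_linear_combination (G : SimpleGraph V) (f g h : V → ℝ) (a b d : ℝ) :
    G.dirichletForm (fun x ↦ a * f x + b * g x + d * h x) (fun x ↦ a * f x + b * g x + d * h x) =
      a ^ 2 * G.dirichletForm f f + b ^ 2 * G.dirichletForm g g + d ^ 2 * G.dirichletForm h h +
      2 * a * d * G.dirichletForm f h + 2 * a * b * G.dirichletForm f g +
      2 * b * d * G.dirichletForm g h := by
  simp only [dirichletForm, ← mul_div_assoc, ← add_div, mul_sum, ← sum_add_distrib]
  congr 1
  refine sum_congr rfl fun x _ ↦ sum_congr rfl fun y _ ↦ ?_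
  split_ifs <;> ring

/-- The number of edges of `G` between `A` and its complement. -/
noncomputable def cutSize (G : SimpleGraph V) (A : Finset V) : ℕ := #(G.interedges A Aᶜ)

/-- The number of edges at `x` in the cut given by `A`; the vertex `x` may be on either side. -/
noncomputable def cutDegree (G : SimpleGraph V) (A : Finset V) (x : V) : ℕ :=
  #{y | G.Adj x y ∧ ¬ (y ∈ A ↔ x ∈ A)}

/-- The function `sideSign A`, set to zero at the vertices without an edge in the cut. -/
noncomputable def boundarySign (G : SimpleGraph V) (A : Finset V) (x : V) : ℝ :=
  if G.cutDegree A x = 0 then 0 else sideSign A x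

lemma cutSize_compl (G : SimpleGraph V) (A : Finset V) : G.cutSize Aᶜ = G.cutSize A := by
  have : Std.Symm G.Adj := ⟨fun _ _ h ↦ h.symm⟩
  have := Rel.card_interedges_comm (r := G.Adj) Aᶜ A
  rw [cutSize, cutSize, compl_compl]
  exact this

lemma cutDegree_compl (G : SimpleGraph V) (A : Finset V) (x : V) :
    G.cutDegree Aᶜ x = G.cutDegree A x := by
  simp only [cutDegree, mem_compl, not_iff_not]

lemma sum_cutDegree (G : SimpleGraph V) (A : Finset V) :
    ∑ x ∈ A, G.cutDegree A x = G.cutSize A := by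
  have h : G.interedges A Aᶜ = (A ×ˢ univ).filter fun p ↦ G.Adj p.1 p.2 ∧ ¬ (p.2 ∈ A ↔ p.1 ∈ A) := by
    ext p
    simp only [mem_interedges_iff, mem_filter, mem_product, mem_compl, mem_univ]
    tauto
  rw [cutSize, h, card_filter, sum_product]
  exact sum_congr rfl fun x _ ↦ card_filter _ _

lemma sum_cutDegree_compl (G : SimpleGraph V) (A : Finset V) :
    ∑ x ∈ Aᶜ, G.cutDegree A x = G.cutSize A := by
  rw [← cutSize_compl, ← sum_cutDegree]
  simp only [cutDegree_compl]

lemma sum_univ_cutDegree (G : SimpleGraph V) (A : Finset V) :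
    ∑ x, (G.cutDegree A x : ℝ) = 2 * G.cutSize A := by
  rw [← sum_add_sum_compl A, ← Nat.cast_sum, ← Nat.cast_sum, sum_cutDegree, sum_cutDegree_compl]
  ring

lemma cutDegree_ne_zero {G : SimpleGraph V} {A : Finset V} {x y : V} (h : G.Adj x y)
    (hxy : ¬ (y ∈ A ↔ x ∈ A)) : G.cutDegree A x ≠ 0 :=
  (card_pos.mpr ⟨y, by simpa using ⟨h, hxy⟩⟩).ne'

lemma exists_adj_of_cutDegree_ne_zero {G : SimpleGraph V} {A : Finset V} {x : V}
    (h : G.cutDegree A x ≠ 0) : ∃ y, G.Adj x y ∧ ¬ (y ∈ A ↔ x ∈ A) := by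
  obtain ⟨y, hy⟩ := card_pos.mp (Nat.pos_of_ne_zero h)
  exact ⟨y, by simpa using hy⟩

lemma sum_sideSign_sub (G : SimpleGraph V) (A : Finset V) (x : V) :
    (∑ y, if G.Adj x y then sideSign A x - sideSign A y else 0) =
      2 * sideSign A x * G.cutDegree A x := by
  rw [cutDegree, ← sum_boole, mul_sum]
  refine sum_congr rfl fun y _ ↦ ?_
  unfold sideSign
  by_cases h1 : G.Adj x y <;> by_cases h2 : x ∈ A <;> by_cases h3 : y ∈ A <;>
    simp [h1, h2, h3] <;> norm_num

lemma dirichletForm_sideSign (G : SimpleGraph V) (A : Finset V) (g : V → ℝ) :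
    G.dirichletForm (sideSign A) g = ∑ x, g x * (2 * sideSign A x * G.cutDegree A x) := by
  rw [dirichletForm_eq_sum]
  simp only [sum_sideSign_sub]

lemma dirichletForm_sideSign_self (G : SimpleGraph V) (A : Finset V) :
    G.dirichletForm (sideSign A) (sideSign A) = 4 * G.cutSize A := by
  have := sum_univ_cutDegree G A
  rw [dirichletForm_sideSign, show (4 * G.cutSize A : ℝ) = 2 * (2 * G.cutSize A) by ring, ← this,
    mul_sum]
  refine sum_congr rfl fun x _ ↦ ?_
  linear_combination (2 * G.cutDegree A x : ℝ) * sideSign_mul_self A x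

lemma dirichletForm_sideSign_boundarySign (G : SimpleGraph V) (A : Finset V) :
    G.dirichletForm (sideSign A) (G.boundarySign A) = 4 * G.cutSize A := by
  rw [← dirichletForm_sideSign_self, dirichletForm_sideSign, dirichletForm_sideSign]
  refine sum_congr rfl fun x _ ↦ ?_
  rw [boundarySign]
  split_ifs with h <;> simp [h]

lemma dirichletForm_single (G : SimpleGraph V) (f : V → ℝ) (u : V) :
    G.dirichletForm f (Pi.single u 1) = ∑ y, if G.Adj u y then f u - f y else 0 := by
  rw [dirichletForm_eq_sum, sum_eq_single u]
  · simp
  · intro b _ hb; simp [hb]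
  · simp

lemma dirichletForm_single_sub_single (G : SimpleGraph V) (f : V → ℝ) (u v : V) :
    G.dirichletForm f (fun x ↦ Pi.single (M := fun _ ↦ ℝ) u 1 x - Pi.single (M := fun _ ↦ ℝ) v 1 x) =
      (∑ y, if G.Adj u y then f u - f y else 0) - ∑ y, if G.Adj v y then f v - f y else 0 := by
  rw [← dirichletForm_single, ← dirichletForm_single]
  simp only [dirichletForm_eq_sum, ← sum_sub_distrib, sub_mul]

/-- Moving a vertex `u` of a regular graph from `A` to the other side changes the size of the
cut by `k` minus twice the number of cut edges at `u`. -/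
lemma cutSize_erase {G : SimpleGraph V} {k : ℕ}
    (hreg : ∀ x, ∑ y, (if G.Adj x y then (1 : ℝ) else 0) = k) {A : Finset V} {u : V}
    (hu : u ∈ A) : G.cutSize (A.erase u) + 2 * G.cutDegree A u = G.cutSize A + k := by
  have h : sideSign (A.erase u) = fun x ↦ 1 * sideSign A x + (-2) * Pi.single (M := fun _ ↦ ℝ) u 1 x
      + 0 * (0 : ℝ) := by
    ext x
    by_cases hx : x = u
    · subst hx; simp [sideSign, hu]; norm_num
    · simp [sideSign, hx]
  have h2 := dirichletForm_sideSign_self G (A.erase u)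
  rw [h, dirichletForm_linear_combination, dirichletForm_sideSign_self, dirichletForm_single,
    dirichletForm_single, sum_sideSign_sub] at h2
  have h3 : (∑ y, if G.Adj u y then
      Pi.single (M := fun _ ↦ ℝ) u 1 u - Pi.single (M := fun _ ↦ ℝ) u 1 y else 0) = k := by
    rw [← hreg u]
    refine sum_congr rfl fun y _ ↦ ?_
    split_ifs with hy
    · simp [hy.ne.symm]
    · rfl
  rw [h3] at h2
  simp only [sideSign, hu, if_true] at h2
  have : (G.cutSize (A.erase u) : ℝ) + 2 * G.cutDegree A u = G.cutSize A + k := by linarith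
  exact_mod_cast this

/-- In a regular graph of even degree all edge cuts are even. -/
lemma even_cutSize {G : SimpleGraph V} {k : ℕ}
    (hreg : ∀ x, ∑ y, (if G.Adj x y then (1 : ℝ) else 0) = k) (hk : Even k) (A : Finset V) :
    Even (G.cutSize A) := by
  induction A using Finset.induction_on with
  | empty => simp [cutSize]
  | insert a s ha ih =>
    have := cutSize_erase hreg (mem_insert_self a s)
    rw [erase_insert ha] at this
    have h2 : Even (G.cutSize (insert a s) + k) := this ▸ ih.add (even_two_mul _)
    exact (Nat.even_add.mp h2).mpr hk

/-- The number of neighbours of `x` on the same side of the cut that have an edge in the cut. -/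
noncomputable def boundaryDegree (G : SimpleGraph V) (A : Finset V) (x : V) : ℕ :=
  #{y | G.Adj x y ∧ (y ∈ A ↔ x ∈ A) ∧ G.cutDegree A y ≠ 0}

lemma sum_boundarySign_sub {G : SimpleGraph V} {k : ℕ}
    (hreg : ∀ x, ∑ y, (if G.Adj x y then (1 : ℝ) else 0) = k) {A : Finset V} {x : V}
    (hx : G.cutDegree A x ≠ 0) :
    (∑ y, if G.Adj x y then G.boundarySign A x - G.boundarySign A y else 0) =
      sideSign A x * (k + G.cutDegree A x - G.boundaryDegree A x) := by
  rw [cutDegree, boundaryDegree, ← sum_boole, ← sum_boole, ← hreg x, ← sum_add_distrib,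
    ← sum_sub_distrib, mul_sum]
  refine sum_congr rfl fun y _ ↦ ?_
  by_cases h1 : G.Adj x y
  swap
  · simp [h1]
  rw [boundarySign, if_neg hx, boundarySign]
  by_cases hs : y ∈ A ↔ x ∈ A
  · have : sideSign A y = sideSign A x := by simp [sideSign, hs]
    by_cases hy : G.cutDegree A y = 0 <;> simp [h1, hs, hy, this]
  · have hy := cutDegree_ne_zero h1.symm fun h ↦ hs h.symm
    have : sideSign A y = - sideSign A x := by
      by_cases h2 : x ∈ A <;> by_cases h3 : y ∈ A <;> simp_all [sideSign]
    simp only [h1, hs, hy, this, if_true, if_false, not_false_eq_true, and_true,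
      false_and, and_false]
    ring

/-- The number of vertices on the side of `x` that have an edge in the cut. -/
noncomputable def boundaryCard (G : SimpleGraph V) (A : Finset V) (x : V) : ℕ :=
  #{y | (y ∈ A ↔ x ∈ A) ∧ G.cutDegree A y ≠ 0}

lemma boundaryDegree_lt {G : SimpleGraph V} {A : Finset V} {x : V} (hx : G.cutDegree A x ≠ 0) :
    G.boundaryDegree A x < G.boundaryCard A x := by
  refine card_lt_card (ssubset_iff_of_subset ?_ |>.mpr ⟨x, by simpa using hx, by simp⟩)
  intro y
  simp only [mem_filter, mem_univ, true_and]
  tauto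

lemma dirichletForm_boundarySign_le {G : SimpleGraph V} {k : ℕ}
    (hreg : ∀ x, ∑ y, (if G.Adj x y then (1 : ℝ) else 0) = k) {A : Finset V} {u v : V}
    (hu : u ∈ A) (hv : v ∉ A) :
    G.dirichletForm (G.boundarySign A) (G.boundarySign A) ≤
      2 * G.cutSize A + k * (G.boundaryCard A u + G.boundaryCard A v) := by
  have h : ∀ x, G.boundarySign A x *
      (∑ y, if G.Adj x y then G.boundarySign A x - G.boundarySign A y else 0) ≤
      G.cutDegree A x + k * ((if (x ∈ A ↔ u ∈ A) ∧ G.cutDegree A x ≠ 0 then 1 else 0) +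
        (if (x ∈ A ↔ v ∈ A) ∧ G.cutDegree A x ≠ 0 then 1 else 0)) := by
    intro x
    by_cases hx : G.cutDegree A x = 0
    · simp [boundarySign, hx]
    rw [sum_boundarySign_sub hreg hx, boundarySign, if_neg hx, ← mul_assoc, sideSign_mul_self]
    have h0 : (0 : ℝ) ≤ G.boundaryDegree A x := Nat.cast_nonneg _
    by_cases hxA : x ∈ A <;> simp [hxA, hu, hv, hx] <;> linarith
  rw [dirichletForm_eq_sum, ← sum_univ_cutDegree, boundaryCard, boundaryCard, ← sum_boole,
    ← sum_boole, ← sum_add_distrib, mul_sum, ← sum_add_distrib]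
  exact sum_le_sum fun x _ ↦ h x

/-- The energy of a test function that is constant on either side of a cut, up to a correction at
the ends of the cut edge `uv` and another one at all ends of cut edges. -/
lemma exists_dirichletForm_le {G : SimpleGraph V} {k : ℕ}
    (hreg : ∀ x, ∑ y, (if G.Adj x y then (1 : ℝ) else 0) = k) {A : Finset V} {u v : V}
    (h : G.Adj u v) (hu : u ∈ A) (hv : v ∉ A) (a : ℝ) {b d : ℝ} (hb : 0 ≤ b) (hd : d ≤ 0) :
    ∃ f : V → ℝ, f u - f v = 2 * (a + b + d) ∧ G.dirichletForm f f ≤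
      a ^ 2 * (4 * G.cutSize A) + b ^ 2 * (2 * k + 2) +
      d ^ 2 * (2 * G.cutSize A + k * (G.boundaryCard A u + G.boundaryCard A v)) +
      2 * a * d * (4 * G.cutSize A) + 2 * a * b * (2 * (G.cutDegree A u + G.cutDegree A v)) +
      2 * b * d * (2 * k + G.cutDegree A u + G.cutDegree A v + 2 -
        G.boundaryCard A u - G.boundaryCard A v) := by
  have hu0 : G.cutDegree A u ≠ 0 := cutDegree_ne_zero h (by tauto)
  have hv0 : G.cutDegree A v ≠ 0 := cutDegree_ne_zero h.symm (by tauto)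
  set δ : V → ℝ := fun x ↦ Pi.single (M := fun _ ↦ ℝ) u 1 x - Pi.single (M := fun _ ↦ ℝ) v 1 x
    with hδ
  have hsu : sideSign A u = 1 := if_pos hu
  have hsv : sideSign A v = -1 := if_neg hv
  have hδu : δ u = 1 := by simp [hδ, h.ne]
  have hδv : δ v = -1 := by simp [hδ, h.ne.symm]
  refine ⟨fun x ↦ a * sideSign A x + b * δ x + d * G.boundarySign A x, ?_, ?_⟩
  · simp only [hsu, hsv, hδu, hδv, boundarySign, if_neg hu0, if_neg hv0]
    ring
  have hsδ : G.dirichletForm (sideSign A) δ = 2 * (G.cutDegree A u + G.cutDegree A v) := by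
    rw [hδ, dirichletForm_single_sub_single, sum_sideSign_sub, sum_sideSign_sub, hsu, hsv]
    ring
  have hδδ : G.dirichletForm δ δ = 2 * k + 2 := by
    have h1 : (∑ y, if G.Adj u y then δ u - δ y else 0) = k + 1 := by
      have : ∀ y, (if G.Adj u y then δ u - δ y else 0) =
          (if G.Adj u y then 1 else 0) + if y = v then 1 else 0 := by
        intro y
        by_cases hy : y = v
        · subst hy; simp only [h, hδu, hδv, if_true]; ring
        · by_cases hy' : G.Adj u y
          · simp [hδ, hy, hy', h.ne, hy'.ne.symm]
          · simp [hy, hy']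
      simp only [this, sum_add_distrib, hreg]
      simp
    have h2 : (∑ y, if G.Adj v y then δ v - δ y else 0) = -(k + 1) := by
      have : ∀ y, (if G.Adj v y then δ v - δ y else 0) =
          -((if G.Adj v y then 1 else 0) + if y = u then 1 else 0) := by
        intro y
        by_cases hy : y = u
        · subst hy; simp only [h.symm, hδu, hδv, if_true]; ring
        · by_cases hy' : G.Adj v y
          · simp [hδ, hy, hy', h.ne.symm, hy'.ne.symm]
          · simp [hy, hy']
      simp only [this, sum_neg_distrib, sum_add_distrib, hreg]
      simp
    have h3 := dirichletForm_single_sub_single G δ u v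
    rw [h1, h2, ← hδ] at h3
    linarith
  have hδg : 2 * k + G.cutDegree A u + G.cutDegree A v + 2 -
        G.boundaryCard A u - G.boundaryCard A v ≤ G.dirichletForm δ (G.boundarySign A) := by
    rw [dirichletForm_comm, hδ, dirichletForm_single_sub_single, sum_boundarySign_sub hreg hu0,
      sum_boundarySign_sub hreg hv0, hsu, hsv]
    have h1 : (G.boundaryDegree A u : ℝ) + 1 ≤ G.boundaryCard A u := by
      exact_mod_cast boundaryDegree_lt hu0
    have h2 : (G.boundaryDegree A v : ℝ) + 1 ≤ G.boundaryCard A v := by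
      exact_mod_cast boundaryDegree_lt hv0
    linarith
  rw [dirichletForm_linear_combination, dirichletForm_sideSign_self,
    dirichletForm_sideSign_boundarySign, hsδ, hδδ]
  have h1 := mul_le_mul_of_nonneg_left (dirichletForm_boundarySign_le hreg hu hv) (sq_nonneg d)
  have h2 := mul_le_mul_of_nonpos_left hδg (mul_nonpos_of_nonneg_of_nonpos hb hd)
  linarith

end Cut

/-! ### Minimum cuts -/

section MinimumCut

open Classical Finset

variable {V : Type*} [Fintype V]

/-- Let the ends of a cut edge have `x` and `y` edges in a minimum cut of size `c`. If `x * y ≤ c`,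
then the resistance bound of `IsEquiarboreal.sq_lt_of_cut` fails, except in two cases. -/
lemma cutDegree_arith {k c x y : ℕ} (hx : 1 ≤ x) (hy : 1 ≤ y) (hxk : 2 * x ≤ k)
    (hyk : 2 * y ≤ k) (hxy : x * y ≤ c) (hc : c < k ∨ c ≤ k ∧ 11 ≤ k) (hpar : Even k → Even c)
    (h : ((k : ℤ) + 1 - x - y) ^ 2 < k + 1 + 2 * c - 2 * x - 2 * y) :
    (k = 5 ∧ c = 4 ∧ x + y = 4) ∨ (k = 7 ∧ c = 6 ∧ x + y = 5) := by
  have hz : 2 * (x + y) ≤ k + 2 ∨ 2 * (x + y) ≤ c + 4 := by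
    rcases Nat.lt_or_ge x 2 with hx2 | hx2
    · left; omega
    rcases Nat.lt_or_ge y 2 with hy2 | hy2
    · left; omega
    · -- `(x - 2) * (y - 2)` is nonnegative
      right; nlinarith
  obtain hk | hk := Nat.lt_or_ge k 8
  · have hc' : c < k := by omega
    have hx4 : x ≤ 3 := by omega
    have hy4 : y ≤ 3 := by omega
    interval_cases k <;> interval_cases x <;> interval_cases y <;> interval_cases c <;>
      simp_all +decide
  · exfalso
    -- the bound on `2 * (x + y)` gives `w ≥ (k - 1) / 2` or `w ≥ (k - 2) / 2`, respectively
    obtain ⟨w, hw⟩ : ∃ w : ℤ, w = k + 1 - x - y := ⟨_, rfl⟩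
    rw [← hw] at h
    rcases hc with hc | ⟨hc, hk'⟩
    · have h1 : (k : ℤ) - 1 ≤ 2 * w := by omega
      nlinarith
    · have h1 : (k : ℤ) - 2 ≤ 2 * w := by omega
      nlinarith

lemma exists_adj_mem_notMem {G : SimpleGraph V} (hG : G.Connected) {A : Finset V}
    (h1 : A.Nonempty) (h2 : Aᶜ.Nonempty) : ∃ u ∈ A, ∃ v ∉ A, G.Adj u v := by
  obtain ⟨a, ha⟩ := h1
  obtain ⟨b, hb⟩ := h2
  obtain ⟨p⟩ := hG.preconnected a b
  obtain ⟨d, -, hd1, hd2⟩ := p.exists_boundary_dart (A : Set V) (by simpa using ha)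
    (by simpa using hb)
  exact ⟨d.fst, by simpa using hd1, d.snd, by simpa using hd2, d.adj⟩

/-- Every cut has an edge `uv` such that the cut degrees of its ends have product at most the size
of the cut: take `u` of maximal cut degree on its side, and then `v` of minimal cut degree. -/
lemma exists_cutDegree_mul_le {G : SimpleGraph V} (hG : G.Connected) {A : Finset V}
    (h1 : A.Nonempty) (h2 : Aᶜ.Nonempty) :
    ∃ u ∈ A, ∃ v ∉ A, G.Adj u v ∧ G.cutDegree A u * G.cutDegree A v ≤ G.cutSize A := by
  obtain ⟨a, ha, b, hb, hab⟩ := exists_adj_mem_notMem hG h1 h2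
  obtain ⟨v, hv, hmin⟩ := exists_min_image ({y | G.Adj a y ∧ ¬ (y ∈ A ↔ a ∈ A)} : Finset V)
    (G.cutDegree A) ⟨b, by simp [hab, ha, hb]⟩
  simp only [mem_filter, mem_univ, true_and] at hv
  refine ⟨a, ha, v, by tauto, hv.1, ?_⟩
  calc G.cutDegree A a * G.cutDegree A v
      = ∑ y with G.Adj a y ∧ ¬ (y ∈ A ↔ a ∈ A), G.cutDegree A v := by
        rw [sum_const, smul_eq_mul, cutDegree]
    _ ≤ ∑ y with G.Adj a y ∧ ¬ (y ∈ A ↔ a ∈ A), G.cutDegree A y := sum_le_sum hmin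
    _ ≤ ∑ y ∈ Aᶜ, G.cutDegree A y := by
        refine sum_le_sum_of_subset fun y hy ↦ ?_
        simp only [mem_filter, mem_univ, true_and] at hy
        rw [mem_compl]
        tauto
    _ = G.cutSize A := sum_cutDegree_compl G A

lemma two_mul_boundaryCard_le {G : SimpleGraph V} {A : Finset V}
    (h : ∀ y, G.cutDegree A y ≠ 0 → 2 ≤ G.cutDegree A y) (x : V) :
    2 * G.boundaryCard A x ≤ G.cutSize A := by
  have hsum : ∑ y with y ∈ A ↔ x ∈ A, G.cutDegree A y = G.cutSize A := by
    by_cases hx : x ∈ A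
    · rw [← sum_cutDegree]
      exact sum_congr (by ext; simp [hx]) fun _ _ ↦ rfl
    · rw [← sum_cutDegree_compl]
      exact sum_congr (by ext; simp [hx]) fun _ _ ↦ rfl
  rw [← hsum, boundaryCard, mul_comm, ← smul_eq_mul, ← sum_const]
  refine (sum_le_sum (g := G.cutDegree A) fun y hy ↦ h y (by simp_all)).trans ?_
  refine sum_le_sum_of_subset fun y hy ↦ ?_
  simp only [mem_filter, mem_univ, true_and] at hy ⊢
  exact hy.1

lemma cutSize_singleton {G : SimpleGraph V} {k : ℕ}
    (hreg : ∀ x, ∑ y, (if G.Adj x y then (1 : ℝ) else 0) = k) (v : V) : G.cutSize {v} = k := by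
  have h1 := cutSize_erase hreg (mem_singleton_self v)
  have h2 := sum_cutDegree G {v}
  have h3 : G.cutSize (({v} : Finset V).erase v) = 0 := by simp [cutSize]
  rw [sum_singleton] at h2
  omega

/-- A vertex on a side of a minimum cut with at least two vertices has at most half of its edges
in the cut. -/
lemma two_mul_cutDegree_le {G : SimpleGraph V} {k : ℕ}
    (hreg : ∀ x, ∑ y, (if G.Adj x y then (1 : ℝ) else 0) = k) {A : Finset V}
    (hmin : ∀ B : Finset V, B.Nonempty → Bᶜ.Nonempty → G.cutSize A ≤ G.cutSize B)
    (hA : 2 ≤ #A) {u : V} (hu : u ∈ A) : 2 * G.cutDegree A u ≤ k := by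
  have h1 := hmin (A.erase u) (card_pos.mp (by rw [card_erase_of_mem hu]; omega)) ⟨u, by simp⟩
  have h2 := cutSize_erase hreg hu
  omega

/-- The resistance bound for a cut edge `uv`, with a test function that is constant on either side
of the cut apart from `u` and `v`. -/
lemma IsEquiarboreal.sq_lt_of_cut {G : SimpleGraph V} (hequi : G.IsEquiarboreal)
    (hG : G.Connected) {k : ℕ} (hk : 1 ≤ k)
    (hreg : ∀ x, ∑ y, (if G.Adj x y then (1 : ℝ) else 0) = k) {A : Finset V} {u v : V}
    (h : G.Adj u v) (hu : u ∈ A) (hv : v ∉ A) (hz : G.cutDegree A u + G.cutDegree A v ≤ k) :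
    ((k : ℤ) + 1 - G.cutDegree A u - G.cutDegree A v) ^ 2 <
      k + 1 + 2 * G.cutSize A - 2 * G.cutDegree A u - 2 * G.cutDegree A v := by
  have hz' : (G.cutDegree A u : ℝ) + G.cutDegree A v ≤ k := by exact_mod_cast hz
  have key : ∀ a : ℝ, a ≤ 1 → 0 < 1 - 2 * a * ((k : ℝ) + 1 - G.cutDegree A u - G.cutDegree A v) +
      a ^ 2 * ((k : ℝ) + 1 + 2 * G.cutSize A - 2 * G.cutDegree A u - 2 * G.cutDegree A v) := by
    intro a ha
    obtain ⟨f, hf, hE⟩ := exists_dirichletForm_le hreg h hu hv a (sub_nonneg.mpr ha) le_rfl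
    have := hequi.mul_sq_lt_dirichletForm hG hk hreg h (f := f) (fun h' ↦ by linarith)
    rw [hf] at this
    nlinarith
  set w : ℝ := (k : ℝ) + 1 - G.cutDegree A u - G.cutDegree A v with hw
  set D : ℝ := (k : ℝ) + 1 + 2 * G.cutSize A - 2 * G.cutDegree A u - 2 * G.cutDegree A v with hD
  suffices w ^ 2 < D by
    rw [hw, hD] at this
    exact_mod_cast this
  by_contra! hwD
  -- The quadratic polynomial is minimal at `w / D`, which may exceed `1`. If `D ≤ w ^ 2`, its value
  -- at `1 / w` is already nonpositive.
  have hw1 : 1 ≤ w := by linarith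
  have h1 := key (1 / w) (by rw [div_le_one (by linarith)]; exact hw1)
  have h2 : 2 * (1 / w) * w = 2 := by field_simp
  have h3 : (1 / w) ^ 2 * D ≤ 1 := by
    rw [div_pow, one_pow, div_mul_eq_mul_div, one_mul, div_le_one (by positivity)]
    exact hwD
  linarith

/-- A minimum cut with fewer than `k` edges, or with `k` edges if `11 ≤ k`, splits off a single
vertex. Otherwise the resistance bound fails at a suitable cut edge. In the two cases `k = 5` and
`k = 7` that `cutDegree_arith` leaves open, all ends of cut edges have cut degree at least two, so
there are few of them, and a test function whose values at these vertices are moved towards zero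
gives a contradiction. -/
lemma IsEquiarboreal.card_eq_one_of_minimum_cut {G : SimpleGraph V} (hequi : G.IsEquiarboreal)
    (hG : G.Connected) {k : ℕ} (hk : 1 ≤ k)
    (hreg : ∀ x, ∑ y, (if G.Adj x y then (1 : ℝ) else 0) = k) {A : Finset V}
    (h1 : A.Nonempty) (h2 : Aᶜ.Nonempty)
    (hmin : ∀ B : Finset V, B.Nonempty → Bᶜ.Nonempty → G.cutSize A ≤ G.cutSize B)
    (hc : G.cutSize A < k ∨ G.cutSize A ≤ k ∧ 11 ≤ k) : #A = 1 ∨ #Aᶜ = 1 := by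
  by_contra! hcard
  have hA : 2 ≤ #A := by have := h1.card_pos; omega
  have hA' : 2 ≤ #Aᶜ := by have := h2.card_pos; omega
  have hdeg : ∀ x, 2 * G.cutDegree A x ≤ k := by
    intro x
    by_cases hx : x ∈ A
    · exact two_mul_cutDegree_le hreg hmin hA hx
    · rw [← cutDegree_compl]
      exact two_mul_cutDegree_le hreg (by simpa only [cutSize_compl] using hmin) hA'
        (mem_compl.mpr hx)
  have hbound : ∀ u ∈ A, ∀ v ∉ A, G.Adj u v →
      ((k : ℤ) + 1 - G.cutDegree A u - G.cutDegree A v) ^ 2 <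
        k + 1 + 2 * G.cutSize A - 2 * G.cutDegree A u - 2 * G.cutDegree A v :=
    fun u hu v hv huv ↦ hequi.sq_lt_of_cut hG hk hreg huv hu hv
      (by have := hdeg u; have := hdeg v; omega)
  obtain ⟨u, hu, v, hv, huv, hle⟩ := exists_cutDegree_mul_le hG h1 h2
  have hexc := cutDegree_arith (Nat.one_le_iff_ne_zero.mpr (cutDegree_ne_zero huv (by tauto)))
    (Nat.one_le_iff_ne_zero.mpr (cutDegree_ne_zero huv.symm (by tauto))) (hdeg u) (hdeg v) hle hc
    (fun hk' ↦ even_cutSize hreg hk' A) (hbound u hu v hv huv)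
  have hkc : (k = 5 ∧ G.cutSize A = 4) ∨ (k = 7 ∧ G.cutSize A = 6) :=
    hexc.imp (fun h ↦ ⟨h.1, h.2.1⟩) (fun h ↦ ⟨h.1, h.2.1⟩)
  have hpair : ∀ x ∈ A, ∀ y ∉ A, G.Adj x y → 2 ≤ G.cutDegree A x ∧ 2 ≤ G.cutDegree A y := by
    intro x hx y hy hxy
    have hb := hbound x hx y hy hxy
    have hdx := hdeg x
    have hdy := hdeg y
    have hx0 := cutDegree_ne_zero hxy (A := A) (by tauto)
    have hy0 := cutDegree_ne_zero hxy.symm (A := A) (by tauto)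
    generalize G.cutDegree A x = p at *
    generalize G.cutDegree A y = q at *
    rcases hkc with ⟨rfl, hc'⟩ | ⟨rfl, hc'⟩ <;> rw [hc'] at hb <;>
      · have hp : p ≤ 3 := by omega
        have hq : q ≤ 3 := by omega
        interval_cases p <;> interval_cases q <;> simp_all +decide
  have htwo : ∀ x, G.cutDegree A x ≠ 0 → 2 ≤ G.cutDegree A x := by
    intro x hx
    obtain ⟨y, hxy, hy⟩ := exists_adj_of_cutDegree_ne_zero hx
    by_cases hxA : x ∈ A
    · exact (hpair x hxA y (by tauto) hxy).1
    · exact (hpair y (by tauto) x hxA hxy.symm).2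
  have hU := two_mul_boundaryCard_le htwo u
  have hW := two_mul_boundaryCard_le htwo v
  rcases hexc with ⟨rfl, hc', hz⟩ | ⟨rfl, hc', hz⟩
  · -- these coefficients minimize the energy bound subject to `a + b + d = 1`; the minimum is `2 * k`
    obtain ⟨f, hf, hE⟩ := exists_dirichletForm_le hreg huv hu hv (1 / 2) (b := 3 / 4)
      (d := -1 / 4) (by norm_num) (by norm_num)
    have hlt := hequi.mul_sq_lt_dirichletForm hG hk hreg huv (f := f) (fun h' ↦ by linarith)
    have hz' : (G.cutDegree A u : ℝ) + G.cutDegree A v = 4 := by exact_mod_cast hz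
    have hU' : (G.boundaryCard A u : ℝ) ≤ 2 := by exact_mod_cast (by omega)
    have hW' : (G.boundaryCard A v : ℝ) ≤ 2 := by exact_mod_cast (by omega)
    rw [hf] at hlt
    rw [hc'] at hE
    push_cast at hE hlt
    linarith
  · -- these coefficients are close to the optimal ones and give less than `13.8`, below `2 * k = 14`
    obtain ⟨f, hf, hE⟩ := exists_dirichletForm_le hreg huv hu hv (2 / 5) (b := 18 / 25)
      (d := -3 / 25) (by norm_num) (by norm_num)
    have hlt := hequi.mul_sq_lt_dirichletForm hG hk hreg huv (f := f) (fun h' ↦ by linarith)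
    have hz' : (G.cutDegree A u : ℝ) + G.cutDegree A v = 5 := by exact_mod_cast hz
    have hU' : (G.boundaryCard A u : ℝ) ≤ 3 := by exact_mod_cast (by omega)
    have hW' : (G.boundaryCard A v : ℝ) ≤ 3 := by exact_mod_cast (by omega)
    rw [hf] at hlt
    rw [hc'] at hE
    push_cast at hE hlt
    linarith

lemma IsEquiarboreal.le_cutSize {G : SimpleGraph V} (hequi : G.IsEquiarboreal)
    (hG : G.Connected) {k : ℕ} (hk : 1 ≤ k)
    (hreg : ∀ x, ∑ y, (if G.Adj x y then (1 : ℝ) else 0) = k) {A : Finset V}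
    (h1 : A.Nonempty) (h2 : Aᶜ.Nonempty) : k ≤ G.cutSize A := by
  obtain ⟨B, hB, hmin⟩ := exists_min_image ({B | B.Nonempty ∧ Bᶜ.Nonempty} : Finset (Finset V))
    G.cutSize ⟨A, by simp only [mem_filter, mem_univ, true_and]; exact ⟨h1, h2⟩⟩
  simp only [mem_filter, mem_univ, true_and] at hB hmin
  refine le_trans ?_ (hmin A ⟨h1, h2⟩)
  by_contra! hlt
  rcases hequi.card_eq_one_of_minimum_cut hG hk hreg hB.1 hB.2 (fun C h h' ↦ hmin C ⟨h, h'⟩)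
    (.inl hlt) with h | h <;> obtain ⟨v, hv⟩ := card_eq_one.mp h
  · rw [hv, cutSize_singleton hreg] at hlt
    exact hlt.false
  · rw [← cutSize_compl, hv, cutSize_singleton hreg] at hlt
    exact hlt.false

lemma ncard_cut (G : SimpleGraph V) (A : Finset V) :
    {e | ∃ u ∈ A, ∃ v ∈ Aᶜ, G.Adj u v ∧ e = s(u, v)}.ncard = G.cutSize A := by
  have h : {e | ∃ u ∈ A, ∃ v ∈ Aᶜ, G.Adj u v ∧ e = s(u, v)} =
      ((G.interedges A Aᶜ).image fun p ↦ s(p.1, p.2) : Finset (Sym2 V)) := by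
    ext e
    simp only [Set.mem_ofPred_eq, coe_image, Set.mem_image, mem_coe, mem_interedges_iff, Prod.exists]
    constructor
    · rintro ⟨u, hu, v, hv, huv, rfl⟩
      exact ⟨u, v, ⟨hu, hv, huv⟩, rfl⟩
    · rintro ⟨u, v, ⟨hu, hv, huv⟩, rfl⟩
      exact ⟨u, hu, v, hv, huv, rfl⟩
  rw [h, Set.ncard_coe_finset, card_image_of_injOn, cutSize]
  rintro ⟨a, b⟩ hab ⟨a', b'⟩ hab' heq
  simp only [mem_coe, mem_interedges_iff, mem_compl] at hab hab'
  rcases Sym2.eq_iff.mp heq with ⟨rfl, rfl⟩ | ⟨rfl, rfl⟩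
  · rfl
  · exact absurd hab.1 hab'.2.1

lemma cut_singleton (G : SimpleGraph V) (v : V) :
    {e | ∃ x ∈ ({v} : Finset V), ∃ y ∈ ({v} : Finset V)ᶜ, G.Adj x y ∧ e = s(x, y)} =
      G.incidenceSet v := by
  ext e
  simp only [Set.mem_ofPred_eq, mem_singleton, exists_eq_left, mem_compl, incidenceSet]
  constructor
  · rintro ⟨y, -, hy, rfl⟩
    exact ⟨hy, Sym2.mem_mk_left _ _⟩
  · rintro ⟨he, hv⟩
    obtain ⟨y, rfl⟩ := Sym2.mem_iff_exists.mp hv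
    exact ⟨y, fun h ↦ G.ne_of_adj he h.symm, he, rfl⟩

lemma cut_compl (G : SimpleGraph V) (A : Finset V) :
    {e | ∃ x ∈ Aᶜ, ∃ y ∈ Aᶜᶜ, G.Adj x y ∧ e = s(x, y)} =
      {e | ∃ x ∈ A, ∃ y ∈ Aᶜ, G.Adj x y ∧ e = s(x, y)} := by
  ext e
  constructor
  · rintro ⟨x, hx, y, hy, hxy, rfl⟩
    exact ⟨y, compl_compl A ▸ hy, x, hx, hxy.symm, Sym2.eq_swap⟩
  · rintro ⟨x, hx, y, hy, hxy, rfl⟩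
    exact ⟨y, hy, x, (compl_compl A).symm ▸ hx, hxy.symm, Sym2.eq_swap⟩

lemma isEdgeCut_iff (G : SimpleGraph V) (C : Set (Sym2 V)) :
    G.IsEdgeCut C ↔ ∃ A : Finset V, A.Nonempty ∧ Aᶜ.Nonempty ∧
      C = {e | ∃ u ∈ A, ∃ v ∈ Aᶜ, G.Adj u v ∧ e = s(u, v)} := by
  constructor
  · rintro ⟨A, h1, h2, rfl⟩
    refine ⟨A.toFinset, by simpa using h1, ?_, by simp⟩
    rwa [← Set.toFinset_compl, Set.toFinset_nonempty]
  · rintro ⟨A, h1, h2, rfl⟩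
    exact ⟨A, by simpa using h1, by rwa [← coe_compl, coe_nonempty], by simp⟩

lemma isEdgeConnected_of_le_cutSize {G : SimpleGraph V} {k : ℕ}
    (h : ∀ A : Finset V, A.Nonempty → Aᶜ.Nonempty → k ≤ G.cutSize A) : G.IsEdgeConnected k := by
  intro u v s hs
  by_contra huv
  let A : Finset V := {w | (G.deleteEdges s).Reachable u w}
  have hle := h A ⟨u, by simp [A]⟩ ⟨v, by simpa [A] using huv⟩
  have hsub : {e | ∃ x ∈ A, ∃ y ∈ Aᶜ, G.Adj x y ∧ e = s(x, y)} ⊆ s := by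
    rintro e ⟨x, hx, y, hy, hxy, rfl⟩
    by_contra he
    have hadj : (G.deleteEdges s).Adj x y := deleteEdges_adj.mpr ⟨hxy, he⟩
    simp only [A, mem_filter, mem_compl, mem_univ, true_and] at hx hy
    exact hy (hx.trans hadj.reachable)
  have hfin : s.Finite := Set.toFinite s
  have hle' := Set.ncard_le_ncard hsub hfin
  rw [ncard_cut] at hle'
  rw [← hfin.cast_ncard_eq, Nat.cast_lt] at hs
  omega

end MinimumCut

end SimpleGraph

theorem theorem1p4 {V : Type*} [Fintype V] (G : SimpleGraph V) [DecidableRel G.Adj] (k : ℕ)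
    (hk : 1 ≤ k) (hconn : G.Connected) (hreg : G.IsRegularOfDegree k)
    (hequi : G.IsEquiarboreal) :
    G.HasEdgeConnectivity k ∧
      (11 ≤ k → ∀ C : Set (Sym2 V),
        (G.IsEdgeCut C ∧ C.ncard = k) ↔ ∃ v : V, C = G.incidenceSet v) := by
  classical
  have hsum : ∀ x, ∑ y, (if G.Adj x y then (1 : ℝ) else 0) = k := by
    intro x
    rw [G.sum_adj_eq_degree, hreg x]
  obtain ⟨v₀⟩ := hconn.nonempty
  obtain ⟨w₀, hw₀⟩ : ∃ w, G.Adj v₀ w := by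
    rw [← G.degree_pos_iff_exists_adj, hreg v₀]
    exact hk
  have : Nontrivial V := ⟨v₀, w₀, hw₀.ne⟩
  have hle : ∀ A : Finset V, A.Nonempty → Aᶜ.Nonempty → k ≤ G.cutSize A :=
    fun A h1 h2 ↦ hequi.le_cutSize hconn hk (by convert hsum) h1 h2
  refine ⟨⟨SimpleGraph.isEdgeConnected_of_le_cutSize (by convert hle), fun j hj ↦ ?_⟩,
    fun hk11 C ↦ ?_⟩
  · exact (SimpleGraph.IsEdgeConnected.le_degree (u := v₀) hj).trans (hreg v₀).le
  rw [SimpleGraph.isEdgeCut_iff]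
  constructor
  · rintro ⟨⟨A, h1, h2, rfl⟩, hC⟩
    have hcut : G.cutSize A = k := by
      rw [← hC, ← SimpleGraph.ncard_cut]
    rcases hequi.card_eq_one_of_minimum_cut hconn hk (by convert hsum) h1 (by convert h2)
      (fun B hB hB' ↦ hcut.trans_le (hle B hB (by convert hB'))) (.inr ⟨hcut.le, hk11⟩)
      with h | h <;> obtain ⟨v, hv⟩ := Finset.card_eq_one.mp h <;> refine ⟨v, ?_⟩
    · rw [hv, ← SimpleGraph.cut_singleton]
    · rw [← SimpleGraph.cut_singleton, ← hv, SimpleGraph.cut_compl]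
  · rintro ⟨v, rfl⟩
    obtain ⟨w, hw⟩ := exists_ne v
    refine ⟨⟨{v}, ⟨v, by simp⟩, ⟨w, by simpa using hw⟩, ?_⟩, ?_⟩
    · rw [← SimpleGraph.cut_singleton]
    · rw [← SimpleGraph.cut_singleton, SimpleGraph.ncard_cut, SimpleGraph.cutSize_singleton]
      convert hsum
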